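/- Let $E$ be a finite set and $\mathcal{L}\subseteq 2^E$ a family of subsets. For $e\in E$ the toggle $t_e:\mathcal{L}\to\mathcal{L}$ is defined by $t_e(X)=X\cup\{e\}$ if $e\notin X$ and $X\cup\{e\}\in\mathcal{L}$; $t_e(X)=X\setminus\{e\}$ if $e\in X$ and $X\setminus\{e\}\in\mathcal{L}$; and $t_e(X)=X$ otherwise. The toggle group $T(\mathcal{L})$ is the subgroup of the symmetric group $\mathfrak{S}_{\mathcal{L}}$ generated by $\{t_e \mid e\in E\}$, and $\mathcal{L}$ is called toggle-alternating if $T(\mathcal{L})$ contains the alternating group $A_{\mathcal{L}}$. Let $P$ be a finite poset and let $\mathcal{A}(P)\subseteq 2^P$ be the set of antichains of $P$. (1) If $P$ is the disjoint union of two posets $P=P_1+P_2$ (elements of $P_1$ being incomparable to elements of $P_2$), then $T(\mathcal{A}(P)) = T(\mathcal{A}(P_1))\times T(\mathcal{A}(P_2))$; that is, $A\mapsto (A\cap P_1,A\cap P_2)$ is a bijection $\mathcal{A}(P)\to\mathcal{A}(P_1)\times\mathcal{A}(P_2)$, and there is a group isomorphism $T(\mathcal{A}(P))\to T(\mathcal{A}(P_1))\times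 T(\mathcal{A}(P_2))$, $g\mapsto (g_1,g_2)$, such that $g(A)\cap P_i=g_i(A\cap P_i)$ for all $g\in T(\mathcal{A}(P))$, all $A\in\mathcal{A}(P)$ and $i=1,2$. (2) If $P$ is not the disjoint union of two nonempty posets, then $\mathcal{A}(P)$ is toggle-alternating. -/

import Mathlib

open Classical in
/-- The toggle `t_e : L → L` of a family `L` of subsets of `E`. -/
noncomputable def toggleFun {E : Type*} (L : Set (Set E)) (e : E) (X : L) : L :=
  if h : e ∉ X.1 ∧ X.1 ∪ {e} ∈ L then ⟨X.1 ∪ {e}, h.2⟩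
  else if h : e ∈ X.1 ∧ X.1 \ {e} ∈ L then ⟨X.1 \ {e}, h.2⟩
  else X

theorem toggleFun_involutive {E : Type*} (L : Set (Set E)) (e : E) :
    Function.Involutive (toggleFun L e) := by
  rintro ⟨X, hX⟩
  by_cases he : e ∈ X
  · have h1 : X \ {e} ∪ {e} = X := by simp [he]
    by_cases h : X \ {e} ∈ L
    · simp [toggleFun, he, h, hX]
    · simp [toggleFun, he, h]
  · have h1 : (X ∪ {e}) \ {e} = X := by simp [he]
    by_cases h : X ∪ {e} ∈ L
    · have h2 : toggleFun L e ⟨X, hX⟩ = ⟨X ∪ {e}, h⟩ := by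
        simp only [toggleFun]; rw [dif_pos ⟨he, h⟩]
      rw [h2]
      simp only [toggleFun]
      rw [dif_neg (by simp), dif_pos ⟨by simp, by rw [h1]; exact hX⟩]
      exact Subtype.ext h1
    · have h2 : toggleFun L e ⟨X, hX⟩ = ⟨X, hX⟩ := by
        simp only [toggleFun]; rw [dif_neg (fun c => h c.2), dif_neg (fun c => he c.1)]
      rw [h2, h2]

/-- The toggle `t_e` as a permutation of `L`. -/
noncomputable def toggle {E : Type*} (L : Set (Set E)) (e : E) : Equiv.Perm L :=
  (toggleFun_involutive L e).toPerm

/-- The (generalized) toggle group `T(L)`: the subgroup of the symmetric group on `L` generated by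
the toggles. -/
def toggleGroup {E : Type*} (L : Set (Set E)) : Subgroup (Equiv.Perm L) :=
  Subgroup.closure (Set.range (toggle L))

open Classical in
/-- `L` is toggle-alternating if `T(L)` contains the alternating group on `L`. -/
def ToggleAlternating {E : Type*} [Finite E] (L : Set (Set E)) : Prop :=
  letI : Fintype L := Fintype.ofFinite L
  alternatingGroup L ≤ toggleGroup L

/-- The family of antichains of a poset. -/
def antichains (P : Type*) [PartialOrder P] : Set (Set P) :=
  {A | IsAntichain (· ≤ ·) A}

/-- `P` is the disjoint union (`P₁ ⊕ P₂` carries the disjoint-union order, in which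
elements of different summands are incomparable) of two nonempty posets. -/
def IsDisjointUnionOfPosets.{u} (P : Type u) [PartialOrder P] : Prop :=
  ∃ (P₁ P₂ : Type u) (_ : PartialOrder P₁) (_ : PartialOrder P₂),
    Nonempty P₁ ∧ Nonempty P₂ ∧ Nonempty (P₁ ⊕ P₂ ≃o P)

/-!
Antichains of a poset are the independent sets of its comparability graph, so everything is about
toggling independent sets of a graph `G`. If `G` is a disjoint union, a toggle acts on one of the
two traces of an independent set and fixes the other, hence the toggle group is a product.

If `G` is connected, its vertex set is reached from a single vertex by successively adding to a
set `U` a vertex `v` adjacent to some `u ∈ U`. Fewer than half of the independent sets in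
`U ∪ {v}` contain `v`, because removing `v` embeds them into those in `U` and misses `{u}`; a
transitive group whose restriction to more than half of the points is primitive is itself
primitive. If `u` has a neighbour `w ∈ U`, the 3-cycle on `∅`, `{u}`, `{w}` lies in the toggle
group for `U`, and all independent sets containing `v` are fixed by the toggle at `u`; commuting a
lift of the 3-cycle with this toggle therefore gives the 3-cycle in the toggle group for
`U ∪ {v}`. Otherwise `U = {u}` and the toggle at `u` is a transposition of the independent sets in
`{u, v}`. Jordan's theorems on primitive groups that contain a transposition or a 3-cycle conclude.
-/

open Equiv Equiv.Perm MulAction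
open scoped symmDiff commutatorElement

section Permutations

variable {α β : Type*}

/-- The pairs of permutations of `α` and `β` that are intertwined by the map `ι : α → β`. -/
def intertwiningPairs (ι : α → β) : Subgroup (Perm α × Perm β) where
  carrier := {p | Function.Semiconj ι p.1 p.2}
  mul_mem' hp hq := hp.comp_right hq
  one_mem' := Function.Semiconj.id_right
  inv_mem' {p} hp x := by
    rw [Prod.fst_inv, Prod.snd_inv, eq_inv_iff_eq, ← hp, ← mul_apply, mul_inv_cancel, one_apply]

/-- The permutations of `α` that are induced along `ι : α → β` by an element of the permutation
group `G` on `β`. For an inclusion `ι` these are the restrictions to `α` of the elements of `G`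
that stabilize `α`. -/
def inducedPerms (ι : α → β) (G : Subgroup (Perm β)) : Subgroup (Perm α) :=
  (intertwiningPairs ι ⊓ G.comap (MonoidHom.snd _ _)).map (MonoidHom.fst _ _)

theorem mem_inducedPerms {ι : α → β} {G : Subgroup (Perm β)} {g : Perm α} :
    g ∈ inducedPerms ι G ↔ ∃ h ∈ G, Function.Semiconj ι g h := by
  constructor
  · rintro ⟨⟨g, h⟩, ⟨hgh, hh⟩, rfl⟩
    exact ⟨h, hh, hgh⟩
  · rintro ⟨h, hh, hgh⟩
    exact ⟨(g, h), ⟨hgh, hh⟩, rfl⟩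

theorem isPreprimitive_mono {H K : Subgroup (Perm α)} (hHK : H ≤ K) :
    IsPreprimitive H α → IsPreprimitive K α := fun _ =>
  let f : α →ₑ[Subgroup.inclusion hHK] α := ⟨id, fun _ _ => rfl⟩
  IsPreprimitive.of_surjective (f := f) Function.surjective_id

theorem isPreprimitive_of_isPreprimitive_inducedPerms [Finite β] {ι : α ↪ β}
    {G : Subgroup (Perm β)} [IsPretransitive G β] (hι : IsPreprimitive (inducedPerms ι G) α)
    (hcard : Nat.card β < 2 * Nat.card α) : IsPreprimitive G β := by
  let K := intertwiningPairs ι ⊓ G.comap (MonoidHom.snd _ _)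
  let toInduced : K →* inducedPerms ι G := (MonoidHom.fst _ _).subgroupMap K
  let _ : MulAction K α := MulAction.compHom α toInduced
  let onDomain : α →ₑ[toInduced] α := ⟨id, fun _ _ => rfl⟩
  let toAmbient : K → G := fun p => ⟨p.1.2, p.2.2⟩
  let inclusion : α →ₑ[toAmbient] β := ⟨ι, fun p => p.2.1⟩
  have : IsPreprimitive K α := (isPreprimitive_congr (f := onDomain)
    (MonoidHom.subgroupMap_surjective _ K) Function.bijective_id).2 hι
  exact IsPreprimitive.of_card_lt (f := inclusion)
    (by rwa [← Set.ncard_range_of_injective ι.injective] at hcard)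

theorem commutatorElement_mul_eq_left {Γ : Type*} [Group Γ] {c k t : Γ} (hc : c ^ 3 = 1)
    (htc : t * c * t⁻¹ = c⁻¹) (htk : Commute t k) : ⁅t, c * k⁆ = c :=
  calc t * (c * k) * t⁻¹ * (c * k)⁻¹ = t * c * (k * t⁻¹) * k⁻¹ * c⁻¹ := by group
    _ = t * c * t⁻¹ * c⁻¹ := by rw [← htk.inv_left.eq]; group
    _ = c⁻¹ * c⁻¹ * c ^ 3 := by rw [htc, hc, mul_one]
    _ = c := by group

theorem conj_swap_mul_swap_eq_inv [DecidableEq α] {t : Perm α} {x y z : α} (hxz : x ≠ z)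
    (hyz : y ≠ z) (htx : t x = y) (hty : t y = x) (htz : t z = z) :
    t * (swap x y * swap x z) * t⁻¹ = (swap x y * swap x z)⁻¹ :=
  calc _ = (t * swap x y * t⁻¹) * (t * swap x z * t⁻¹) := by group
    _ = swap x y * swap y z := by
      rw [← swap_apply_apply, ← swap_apply_apply, htx, hty, htz, swap_comm]
    _ = swap x z * swap x y := by
      rw [mul_swap_eq_swap_mul, swap_apply_right, swap_apply_of_ne_of_ne hxz.symm hyz.symm]
    _ = _ := by rw [mul_inv_rev, swap_inv, swap_inv]

/-- A lift of the 3-cycle may move points outside the range of `ι`, but this excess commutes with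
`t`, so the commutator with `t` removes it. -/
theorem swap_mul_swap_mem_of_mem_inducedPerms [DecidableEq α] [DecidableEq β] [Finite β]
    {ι : α ↪ β} {G : Subgroup (Perm β)} {x y z : α} (hxy : x ≠ y) (hxz : x ≠ z) (hyz : y ≠ z)
    (hc : swap x y * swap x z ∈ inducedPerms ι G) {t : Perm β} (ht : t ∈ G)
    (htx : t (ι x) = ι y) (hty : t (ι y) = ι x) (htz : t (ι z) = ι z)
    (htι : ∀ w ∉ Set.range ι, t w = w) :
    swap (ι x) (ι y) * swap (ι x) (ι z) ∈ G := by
  have := Fintype.ofFinite β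
  obtain ⟨h, hh, hsemi⟩ := mem_inducedPerms.1 hc
  set c := swap (ι x) (ι y) * swap (ι x) (ι z) with c_def
  have hcycle : c.IsThreeCycle := isThreeCycle_swap_mul_swap_same
    (ι.injective.ne hxy) (ι.injective.ne hxz) (ι.injective.ne hyz)
  have hcube : c ^ 3 = 1 := hcycle.orderOf ▸ pow_orderOf_eq_one c
  have hconj : t * c * t⁻¹ = c⁻¹ :=
    conj_swap_mul_swap_eq_inv (ι.injective.ne hxz) (ι.injective.ne hyz) htx hty htz
  have hdisj : t.Disjoint (c⁻¹ * h) := by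
    intro w
    by_cases hw : w ∈ Set.range ι
    · obtain ⟨w, rfl⟩ := hw
      right
      rw [mul_apply, ← hsemi, inv_eq_iff_eq, c_def, mul_apply, mul_apply,
        ι.injective.swap_apply, ι.injective.swap_apply]
    · exact Or.inl (htι w hw)
  have hcomm := commutatorElement_mul_eq_left hcube hconj hdisj.commute
  rw [mul_inv_cancel_left] at hcomm
  rw [← hcomm]
  exact mul_mem (mul_mem (mul_mem ht hh) (inv_mem ht)) (inv_mem hh)

theorem card_lt_two_mul_ncard_of_mapsTo_compl [Finite α] {t : α → α} (ht : Function.Injective t)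
    {S : Set α} (hS : Set.MapsTo t Sᶜ S) {w : α} (hw : w ∈ S) (htw : t w = w) :
    Nat.card α < 2 * S.ncard := by
  have himage : t '' Sᶜ ⊂ S := by
    refine ⟨hS.image_subset, fun h => ?_⟩
    obtain ⟨w', hw', htw'⟩ := h hw
    exact hw' (ht (htw'.trans htw.symm) ▸ hw)
  have hlt := Set.ncard_lt_ncard himage
  rw [Set.ncard_image_of_injective _ ht] at hlt
  have hsum := Set.ncard_add_ncard_compl S
  omega

/-- The action of pairs of permutations of `β` and `γ` on a type identified with `β × γ`. -/
def prodPermHom {γ : Type*} (φ : α ≃ β × γ) : Perm β × Perm γ →* Perm α where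
  toFun g := φ.symm.permCongr (g.1.prodCongr g.2)
  map_one' := by ext a; simp
  map_mul' g h := by ext a; simp [Prod.map]

theorem apply_prodPermHom {γ : Type*} (φ : α ≃ β × γ) (g : Perm β × Perm γ) (a : α) :
    φ (prodPermHom φ g a) = (g.1 (φ a).1, g.2 (φ a).2) := by
  simp [prodPermHom, Prod.map]

theorem prodPermHom_injective {γ : Type*} [Nonempty β] [Nonempty γ] (φ : α ≃ β × γ) :
    Function.Injective (prodPermHom φ) := by
  intro g h hgh
  have hmap (p : β × γ) : (g.1 p.1, g.2 p.2) = (h.1 p.1, h.2 p.2) := by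
    obtain ⟨a, rfl⟩ := φ.surjective p
    rw [← apply_prodPermHom, ← apply_prodPermHom, hgh]
  obtain ⟨b₀⟩ := ‹Nonempty β›
  obtain ⟨c₀⟩ := ‹Nonempty γ›
  exact Prod.ext (Equiv.ext fun b => congrArg Prod.fst (hmap (b, c₀)))
    (Equiv.ext fun c => congrArg Prod.snd (hmap (b₀, c)))

end Permutations

section Toggle

variable {E : Type*} {L : Set (Set E)} {e : E}

theorem toggle_mem_toggleGroup (L : Set (Set E)) (e : E) : toggle L e ∈ toggleGroup L :=
  Subgroup.subset_closure ⟨e, rfl⟩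

theorem toggle_toggle (L : Set (Set E)) (e : E) (X : L) : toggle L e (toggle L e X) = X :=
  toggleFun_involutive L e X

theorem symmDiff_singleton_of_mem {X : Set E} (he : e ∈ X) : X ∆ {e} = X \ {e} :=
  symmDiff_of_ge (Set.singleton_subset_iff.2 he)

theorem symmDiff_singleton_of_notMem {X : Set E} (he : e ∉ X) : X ∆ {e} = X ∪ {e} :=
  (Set.disjoint_singleton_right.2 he).symmDiff_eq_sup

theorem toggle_apply_of_symmDiff_mem {X : L} (h : X.1 ∆ {e} ∈ L) :
    toggle L e X = ⟨X.1 ∆ {e}, h⟩ := by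
  change toggleFun L e X = _
  by_cases he : e ∈ X.1
  · simp only [symmDiff_singleton_of_mem he] at h ⊢
    rw [toggleFun, dif_neg (fun hX => hX.1 he), dif_pos ⟨he, h⟩]
  · simp only [symmDiff_singleton_of_notMem he] at h ⊢
    rw [toggleFun, dif_pos ⟨he, h⟩]

theorem toggle_apply_of_symmDiff_notMem {X : L} (h : X.1 ∆ {e} ∉ L) : toggle L e X = X := by
  change toggleFun L e X = X
  by_cases he : e ∈ X.1
  · rw [symmDiff_singleton_of_mem he] at h
    rw [toggleFun, dif_neg (fun hX => hX.1 he), dif_neg (fun hX => h hX.2)]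
  · rw [symmDiff_singleton_of_notMem he] at h
    rw [toggleFun, dif_neg (fun hX => h hX.2), dif_neg (fun hX => he hX.1)]

theorem toggleAlternating_iff [Finite E] [Fintype L] [DecidableEq L] :
    ToggleAlternating L ↔ alternatingGroup L ≤ toggleGroup L := by
  unfold ToggleAlternating
  convert Iff.rfl

theorem toggleAlternating_of_subsingleton [Finite E] (hL : L.Subsingleton) :
    ToggleAlternating L := by
  have : Subsingleton L := hL.coe_sort
  exact fun g _ => Subsingleton.elim 1 g ▸ one_mem _

theorem isPretransitive_toggleGroup [Finite E] (hL : IsLowerSet L) :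
    IsPretransitive (toggleGroup L) L := by
  rcases L.eq_empty_or_nonempty with rfl | ⟨Y, hY⟩
  · exact ⟨fun X => X.2.elim⟩
  have hempty : ∅ ∈ L := hL (Set.empty_subset Y) hY
  refine (isPretransitive_iff_base ⟨∅, hempty⟩).2 fun ⟨X, hX⟩ => ?_
  induction X, X.toFinite using Set.Finite.induction_on with
  | empty => exact ⟨1, one_smul _ _⟩
  | @insert e X he _ ih =>
    obtain ⟨g, hg⟩ := ih (hL (Set.subset_insert e X) hX)
    refine ⟨⟨toggle L e, toggle_mem_toggleGroup L e⟩ * g, ?_⟩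
    have hinsert : X ∆ {e} = insert e X := by
      rw [symmDiff_singleton_of_notMem he, Set.union_singleton]
    have hmem : X ∆ {e} ∈ L := hinsert.symm ▸ hX
    rw [mul_smul, hg]
    exact (toggle_apply_of_symmDiff_mem hmem).trans (Subtype.ext hinsert)

end Toggle

section SumFamily

variable {E E₁ E₂ : Type*} (e : E₁ ⊕ E₂ ≃ E) (L₁ : Set (Set E₁)) (L₂ : Set (Set E₂))

/-- The family of subsets of `E ≃ E₁ ⊕ E₂` whose trace on `E₁` lies in `L₁` and whose trace on `E₂`
lies in `L₂`. -/
def sumFamily : Set (Set E) :=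
  {X | {x | e (Sum.inl x) ∈ X} ∈ L₁ ∧ {y | e (Sum.inr y) ∈ X} ∈ L₂}

/-- A member of `sumFamily e L₁ L₂` amounts to the pair of its traces on `E₁` and `E₂`. -/
def sumFamilyEquiv : sumFamily e L₁ L₂ ≃ L₁ × L₂ where
  toFun X := (⟨_, X.2.1⟩, ⟨_, X.2.2⟩)
  invFun X := ⟨{p | Sum.elim (· ∈ X.1.1) (· ∈ X.2.1) (e.symm p)}, by simp [sumFamily]⟩
  left_inv X := by
    refine Subtype.ext (Set.ext fun p => ?_)
    obtain ⟨p | p, rfl⟩ := e.surjective p <;> simp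
  right_inv X := by simp

theorem prodPermHom_toggle_inl (x : E₁) :
    prodPermHom (sumFamilyEquiv e L₁ L₂) (toggle L₁ x, 1) =
      toggle (sumFamily e L₁ L₂) (e (Sum.inl x)) := by
  refine Equiv.ext fun X => (sumFamilyEquiv e L₁ L₂).injective ?_
  rw [apply_prodPermHom]
  have hinl : {x' | e (Sum.inl x') ∈ X.1 ∆ {e (Sum.inl x)}} =
      {x' | e (Sum.inl x') ∈ X.1} ∆ {x} := by ext; simp [Set.mem_symmDiff]
  have hinr : {y | e (Sum.inr y) ∈ X.1 ∆ {e (Sum.inl x)}} = {y | e (Sum.inr y) ∈ X.1} := by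
    ext; simp [Set.mem_symmDiff]
  by_cases h : {x' | e (Sum.inl x') ∈ X.1} ∆ {x} ∈ L₁
  · have h' : X.1 ∆ {e (Sum.inl x)} ∈ sumFamily e L₁ L₂ := ⟨hinl ▸ h, hinr ▸ X.2.2⟩
    rw [toggle_apply_of_symmDiff_mem h']
    exact Prod.ext ((toggle_apply_of_symmDiff_mem (X := (sumFamilyEquiv e L₁ L₂ X).1) h).trans
      (Subtype.ext hinl.symm)) (Subtype.ext hinr.symm)
  · have h' : X.1 ∆ {e (Sum.inl x)} ∉ sumFamily e L₁ L₂ := fun h' => h (hinl ▸ h'.1)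
    rw [toggle_apply_of_symmDiff_notMem h']
    exact Prod.ext (toggle_apply_of_symmDiff_notMem (X := (sumFamilyEquiv e L₁ L₂ X).1) h) rfl

theorem prodPermHom_toggle_inr (y : E₂) :
    prodPermHom (sumFamilyEquiv e L₁ L₂) (1, toggle L₂ y) =
      toggle (sumFamily e L₁ L₂) (e (Sum.inr y)) := by
  refine Equiv.ext fun X => (sumFamilyEquiv e L₁ L₂).injective ?_
  rw [apply_prodPermHom]
  have hinl : {x | e (Sum.inl x) ∈ X.1 ∆ {e (Sum.inr y)}} = {x | e (Sum.inl x) ∈ X.1} := by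
    ext; simp [Set.mem_symmDiff]
  have hinr : {y' | e (Sum.inr y') ∈ X.1 ∆ {e (Sum.inr y)}} =
      {y' | e (Sum.inr y') ∈ X.1} ∆ {y} := by ext; simp [Set.mem_symmDiff]
  by_cases h : {y' | e (Sum.inr y') ∈ X.1} ∆ {y} ∈ L₂
  · have h' : X.1 ∆ {e (Sum.inr y)} ∈ sumFamily e L₁ L₂ := ⟨hinl ▸ X.2.1, hinr ▸ h⟩
    rw [toggle_apply_of_symmDiff_mem h']
    exact Prod.ext (Subtype.ext hinl.symm) ((toggle_apply_of_symmDiff_mem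
      (X := (sumFamilyEquiv e L₁ L₂ X).2) h).trans (Subtype.ext hinr.symm))
  · have h' : X.1 ∆ {e (Sum.inr y)} ∉ sumFamily e L₁ L₂ := fun h' => h (hinr ▸ h'.2)
    rw [toggle_apply_of_symmDiff_notMem h']
    exact Prod.ext rfl (toggle_apply_of_symmDiff_notMem (X := (sumFamilyEquiv e L₁ L₂ X).2) h)

theorem map_prodPermHom_toggleGroup :
    ((toggleGroup L₁).prod (toggleGroup L₂)).map (prodPermHom (sumFamilyEquiv e L₁ L₂)) =
      toggleGroup (sumFamily e L₁ L₂) := by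
  apply le_antisymm
  · rw [Subgroup.map_le_iff_le_comap, Subgroup.prod_le_iff, Subgroup.map_le_iff_le_comap,
      Subgroup.map_le_iff_le_comap]
    constructor
    · refine (Subgroup.closure_le _).2 (Set.range_subset_iff.2 fun x => ?_)
      change prodPermHom (sumFamilyEquiv e L₁ L₂) (toggle L₁ x, 1) ∈ toggleGroup (sumFamily e L₁ L₂)
      exact prodPermHom_toggle_inl e L₁ L₂ x ▸ toggle_mem_toggleGroup _ _
    · refine (Subgroup.closure_le _).2 (Set.range_subset_iff.2 fun y => ?_)
      change prodPermHom (sumFamilyEquiv e L₁ L₂) (1, toggle L₂ y) ∈ toggleGroup (sumFamily e L₁ L₂)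
      exact prodPermHom_toggle_inr e L₁ L₂ y ▸ toggle_mem_toggleGroup _ _
  · refine (Subgroup.closure_le _).2 (Set.range_subset_iff.2 fun p => ?_)
    obtain ⟨x | y, rfl⟩ := e.surjective p
    · exact ⟨_, ⟨toggle_mem_toggleGroup _ x, one_mem _⟩, prodPermHom_toggle_inl e L₁ L₂ x⟩
    · exact ⟨_, ⟨one_mem _, toggle_mem_toggleGroup _ y⟩, prodPermHom_toggle_inr e L₁ L₂ y⟩

variable {L₁ L₂}

theorem exists_toggleGroup_sumFamily_mulEquiv (h₁ : L₁.Nonempty) (h₂ : L₂.Nonempty) :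
    ∃ Φ : toggleGroup (sumFamily e L₁ L₂) ≃* toggleGroup L₁ × toggleGroup L₂,
      ∀ (g : toggleGroup (sumFamily e L₁ L₂)) (X : sumFamily e L₁ L₂),
        sumFamilyEquiv e L₁ L₂ (g.1 X) =
          ((Φ g).1.1 (sumFamilyEquiv e L₁ L₂ X).1, (Φ g).2.1 (sumFamilyEquiv e L₁ L₂ X).2) := by
  have := h₁.to_subtype
  have := h₂.to_subtype
  let Ψ : toggleGroup L₁ × toggleGroup L₂ ≃* toggleGroup (sumFamily e L₁ L₂) :=
    ((Subgroup.prodEquiv _ _).symm.trans (Subgroup.equivMapOfInjective _ _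
      (prodPermHom_injective (sumFamilyEquiv e L₁ L₂)))).trans
        (MulEquiv.subgroupCongr (map_prodPermHom_toggleGroup e L₁ L₂))
  refine ⟨Ψ.symm, fun g X => ?_⟩
  obtain ⟨g, rfl⟩ := Ψ.surjective g
  rw [Ψ.symm_apply_apply]
  exact apply_prodPermHom _ (g.1.1, g.2.1) X

end SumFamily

section IndependentSets

variable {V : Type*} {G : SimpleGraph V}

/-- The family of independent sets of `G`. -/
def independentSets (G : SimpleGraph V) : Set (Set V) := {X | G.IsIndepSet X}

/-- The family of independent sets of `G` that are contained in `U`, which stands for the family of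
independent sets of the subgraph induced on `U` but keeps all families inside `Set V`. -/
def independentSetsIn (G : SimpleGraph V) (U : Set V) : Set (Set V) :=
  {X | X ⊆ U ∧ X ∈ independentSets G}

variable {U W : Set V} {u v w : V}

theorem independentSets_nonempty (G : SimpleGraph V) : (independentSets G).Nonempty :=
  ⟨∅, Set.pairwise_empty _⟩

theorem independentSets_eq_sumFamily {V₁ V₂ : Type*} {G₁ : SimpleGraph V₁} {G₂ : SimpleGraph V₂}
    (e : G₁ ⊕g G₂ ≃g G) :
    independentSets G = sumFamily e.toEquiv (independentSets G₁) (independentSets G₂) := by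
  ext X
  constructor
  · intro hX
    exact ⟨fun x hx y hy hxy hadj => hX hx hy (e.injective.ne (Sum.inl_injective.ne hxy))
        (e.map_adj_iff.2 hadj),
      fun x hx y hy hxy hadj => hX hx hy (e.injective.ne (Sum.inr_injective.ne hxy))
        (e.map_adj_iff.2 hadj)⟩
  · rintro ⟨h₁, h₂⟩ p hp q hq - hadj
    obtain ⟨x | x, rfl⟩ := e.surjective p <;> obtain ⟨y | y, rfl⟩ := e.surjective q
    · have hxy : G₁.Adj x y := e.map_adj_iff.1 hadj
      exact h₁ hp hq hxy.ne hxy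
    · simpa using e.map_adj_iff.1 hadj
    · simpa using e.map_adj_iff.1 hadj
    · have hxy : G₂.Adj x y := e.map_adj_iff.1 hadj
      exact h₂ hp hq hxy.ne hxy

theorem independentSetsIn_univ : independentSetsIn G Set.univ = independentSets G :=
  Set.ext fun X => and_iff_right (Set.subset_univ X)

theorem independentSetsIn_mono (h : U ⊆ W) : independentSetsIn G U ⊆ independentSetsIn G W :=
  fun _ hX => ⟨hX.1.trans h, hX.2⟩

theorem isLowerSet_independentSetsIn : IsLowerSet (independentSetsIn G U) :=
  fun _ _ hYX hX => ⟨hYX.trans hX.1, Set.Pairwise.mono hYX hX.2⟩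

theorem empty_mem_independentSetsIn : ∅ ∈ independentSetsIn G U :=
  ⟨Set.empty_subset U, Set.pairwise_empty _⟩

theorem singleton_mem_independentSetsIn (hv : v ∈ U) : {v} ∈ independentSetsIn G U :=
  ⟨Set.singleton_subset_iff.2 hv, Set.pairwise_singleton _ _⟩

theorem symmDiff_mem_independentSetsIn_iff {X : Set V} (hU : U ⊆ W)
    (hX : X ∈ independentSetsIn G U) (hv : v ∈ U) :
    X ∆ {v} ∈ independentSetsIn G W ↔ X ∆ {v} ∈ independentSetsIn G U :=
  ⟨fun h => ⟨Set.symmDiff_subset_union.trans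
    (Set.union_subset hX.1 (Set.singleton_subset_iff.2 hv)), h.2⟩,
    fun h => independentSetsIn_mono hU h⟩

theorem toggle_independentSetsIn_of_notMem {X : independentSetsIn G U} (hv : v ∉ U) :
    toggle (independentSetsIn G U) v X = X :=
  toggle_apply_of_symmDiff_notMem fun h =>
    hv (h.1 (Set.mem_symmDiff.2 (Or.inr ⟨rfl, fun hvX => hv (X.2.1 hvX)⟩)))

theorem toggle_independentSetsIn_of_adj {X : independentSetsIn G U} (hu : u ∈ X.1)
    (huv : G.Adj u v) :
    toggle (independentSetsIn G U) v X = X := by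
  have hvX : v ∉ X.1 := fun hv => X.2.2 hu hv huv.ne huv
  refine toggle_apply_of_symmDiff_notMem fun h => ?_
  rw [symmDiff_singleton_of_notMem hvX] at h
  exact h.2 (Or.inl hu) (Or.inr rfl) huv.ne huv

theorem coe_toggle_independentSetsIn_of_mem {X : independentSetsIn G U} (hv : v ∈ X.1) :
    (toggle (independentSetsIn G U) v X).1 = X.1 \ {v} := by
  have h := symmDiff_singleton_of_mem hv
  have hmem : X.1 ∆ {v} ∈ independentSetsIn G U :=
    isLowerSet_independentSetsIn (h.trans_le Set.sdiff_subset) X.2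
  exact (congrArg Subtype.val (toggle_apply_of_symmDiff_mem hmem)).trans h

theorem toggle_independentSetsIn_empty (hv : v ∈ U) :
    toggle (independentSetsIn G U) v ⟨∅, empty_mem_independentSetsIn⟩ =
      ⟨{v}, singleton_mem_independentSetsIn hv⟩ := by
  have h : (∅ : Set V) ∆ {v} = {v} := bot_symmDiff _
  have hmem : (∅ : Set V) ∆ {v} ∈ independentSetsIn G U :=
    h.symm ▸ singleton_mem_independentSetsIn hv
  exact (toggle_apply_of_symmDiff_mem hmem).trans (Subtype.ext h)

theorem toggle_independentSetsIn_singleton (hv : v ∈ U) :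
    toggle (independentSetsIn G U) v ⟨{v}, singleton_mem_independentSetsIn hv⟩ =
      ⟨∅, empty_mem_independentSetsIn⟩ := by
  rw [← toggle_independentSetsIn_empty hv, toggle_toggle]

theorem isSwap_toggle_independentSetsIn [DecidableEq (Set V)] (hv : v ∈ U)
    (hadj : ∀ u ∈ U, u ≠ v → G.Adj u v) :
    (toggle (independentSetsIn G U) v).IsSwap := by
  refine ⟨⟨∅, empty_mem_independentSetsIn⟩, ⟨{v}, singleton_mem_independentSetsIn hv⟩,
    fun h => Set.singleton_ne_empty v (congrArg Subtype.val h).symm, Equiv.ext fun X => ?_⟩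
  by_cases hX : X.1 ⊆ {v}
  · rcases Set.subset_singleton_iff_eq.1 hX with hX | hX
    · obtain rfl : X = ⟨∅, empty_mem_independentSetsIn⟩ := Subtype.ext hX
      rw [swap_apply_left, toggle_independentSetsIn_empty hv]
    · obtain rfl : X = ⟨{v}, singleton_mem_independentSetsIn hv⟩ := Subtype.ext hX
      rw [swap_apply_right, toggle_independentSetsIn_singleton hv]
  · rw [swap_apply_of_ne_of_ne (by rintro rfl; exact hX (Set.empty_subset _))
      (by rintro rfl; exact hX Set.Subset.rfl)]
    obtain ⟨u, hu, huv⟩ := Set.not_subset.1 hX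
    exact toggle_independentSetsIn_of_adj hu (hadj u (X.2.1 hu) huv)

/-- The inclusion of the independent sets contained in `U` into those contained in `W ⊇ U`. -/
abbrev independentSetsEmbedding (G : SimpleGraph V) (h : U ⊆ W) :
    independentSetsIn G U ↪ independentSetsIn G W :=
  Set.embeddingOfSubset _ _ (independentSetsIn_mono h)

theorem toggleGroup_independentSetsIn_le_inducedPerms (h : U ⊆ W) :
    toggleGroup (independentSetsIn G U) ≤
      inducedPerms (independentSetsEmbedding G h) (toggleGroup (independentSetsIn G W)) := by
  rw [toggleGroup, Subgroup.closure_le, Set.range_subset_iff]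
  intro e
  rw [SetLike.mem_coe, mem_inducedPerms]
  by_cases he : e ∈ U
  · refine ⟨_, toggle_mem_toggleGroup _ e, fun X => ?_⟩
    have hiff := symmDiff_mem_independentSetsIn_iff h X.2 he
    by_cases hX : X.1 ∆ {e} ∈ independentSetsIn G U
    · rw [toggle_apply_of_symmDiff_mem hX]
      exact (toggle_apply_of_symmDiff_mem (X := independentSetsEmbedding G h X) (hiff.2 hX)).symm
    · rw [toggle_apply_of_symmDiff_notMem hX]
      exact (toggle_apply_of_symmDiff_notMem (X := independentSetsEmbedding G h X)
        fun hX' => hX (hiff.1 hX')).symm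
  · exact ⟨1, one_mem _, fun X => congrArg _ (toggle_independentSetsIn_of_notMem he)⟩

theorem mem_range_independentSetsEmbedding {X : independentSetsIn G (insert v U)} (hv : v ∉ X.1) :
    X ∈ Set.range (independentSetsEmbedding G (Set.subset_insert v U)) :=
  ⟨⟨X.1, (Set.subset_insert_iff_of_notMem hv).1 X.2.1, X.2.2⟩, rfl⟩

section Finite

variable [Finite V]

theorem card_independentSetsIn_insert_lt (hu : u ∈ U) (huv : G.Adj u v) :
    Nat.card (independentSetsIn G (insert v U)) < 2 * Nat.card (independentSetsIn G U) := by
  let ι := independentSetsEmbedding G (Set.subset_insert v U)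
  rw [← Set.ncard_range_of_injective ι.injective]
  refine card_lt_two_mul_ncard_of_mapsTo_compl (toggle _ v).injective (fun X hX => ?_)
    ⟨⟨{u}, singleton_mem_independentSetsIn hu⟩, rfl⟩ (toggle_independentSetsIn_of_adj rfl huv)
  have hvX : v ∈ X.1 := by_contra fun h => hX (mem_range_independentSetsEmbedding h)
  exact mem_range_independentSetsEmbedding fun h => by
    rw [coe_toggle_independentSetsIn_of_mem hvX] at h
    exact h.2 rfl

theorem isPreprimitive_toggleGroup_independentSetsIn_insert (hu : u ∈ U) (huv : G.Adj u v)
    (hU : IsPreprimitive (toggleGroup (independentSetsIn G U)) (independentSetsIn G U)) :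
    IsPreprimitive (toggleGroup (independentSetsIn G (insert v U)))
      (independentSetsIn G (insert v U)) :=
  have := isPretransitive_toggleGroup (isLowerSet_independentSetsIn (G := G) (U := insert v U))
  isPreprimitive_of_isPreprimitive_inducedPerms
    (isPreprimitive_mono (toggleGroup_independentSetsIn_le_inducedPerms (Set.subset_insert v U)) hU)
    (card_independentSetsIn_insert_lt hu huv)

theorem toggleAlternating_independentSetsIn_of_forall_adj (hv : v ∈ U)
    (hadj : ∀ u ∈ U, u ≠ v → G.Adj u v)
    (hU : IsPreprimitive (toggleGroup (independentSetsIn G U)) (independentSetsIn G U)) :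
    ToggleAlternating (independentSetsIn G U) := by
  classical
  have := Fintype.ofFinite (independentSetsIn G U)
  rw [toggleAlternating_iff, subgroup_eq_top_of_isPreprimitive_of_isSwap_mem hU _
    (isSwap_toggle_independentSetsIn hv hadj) (toggle_mem_toggleGroup _ v)]
  exact le_top

theorem isPreprimitive_toggleGroup_independentSetsIn_singleton (v : V) :
    IsPreprimitive (toggleGroup (independentSetsIn G {v})) (independentSetsIn G {v}) where
  toIsPretransitive := isPretransitive_toggleGroup isLowerSet_independentSetsIn
  isTrivialBlock_of_isBlock {B} _ := by
    refine isTrivialBlock_of_card_le_two ?_ B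
    calc Nat.card (independentSetsIn G {v}) ≤ (𝒫 {v} : Set (Set V)).ncard :=
          Set.ncard_le_ncard fun X hX => hX.1
      _ = 2 := by rw [Set.ncard_powerset, Set.ncard_singleton, pow_one]

theorem toggleAlternating_independentSetsIn_insert (hu : u ∈ U) (hw : w ∈ U) (huw : G.Adj u w)
    (huv : G.Adj u v)
    (hprim : IsPreprimitive (toggleGroup (independentSetsIn G U)) (independentSetsIn G U))
    (halt : ToggleAlternating (independentSetsIn G U)) :
    ToggleAlternating (independentSetsIn G (insert v U)) := by
  classical
  have := Fintype.ofFinite (independentSetsIn G U)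
  have := Fintype.ofFinite (independentSetsIn G (insert v U))
  rw [toggleAlternating_iff] at halt ⊢
  let ι := independentSetsEmbedding G (Set.subset_insert v U)
  let x : independentSetsIn G U := ⟨∅, empty_mem_independentSetsIn⟩
  let y : independentSetsIn G U := ⟨{u}, singleton_mem_independentSetsIn hu⟩
  let z : independentSetsIn G U := ⟨{w}, singleton_mem_independentSetsIn hw⟩
  have hxy : x ≠ y := fun h => Set.singleton_ne_empty u (congrArg Subtype.val h).symm
  have hxz : x ≠ z := fun h => Set.singleton_ne_empty w (congrArg Subtype.val h).symm
  have hyz : y ≠ z := fun h => huw.ne (Set.singleton_injective (congrArg Subtype.val h))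
  have hcycle : swap x y * swap x z ∈ inducedPerms ι (toggleGroup _) :=
    toggleGroup_independentSetsIn_le_inducedPerms _
      (halt (isThreeCycle_swap_mul_swap_same hxy hxz hyz).mem_alternatingGroup)
  have hfix : ∀ X ∉ Set.range ι, toggle (independentSetsIn G (insert v U)) u X = X := fun X hX =>
    toggle_independentSetsIn_of_adj
      (by_contra fun h => hX (mem_range_independentSetsEmbedding h)) huv.symm
  have hmem : swap (ι x) (ι y) * swap (ι x) (ι z) ∈ toggleGroup _ :=
    swap_mul_swap_mem_of_mem_inducedPerms hxy hxz hyz hcycle (toggle_mem_toggleGroup _ u)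
      (toggle_independentSetsIn_empty (Set.mem_insert_of_mem v hu))
      (toggle_independentSetsIn_singleton (Set.mem_insert_of_mem v hu))
      (toggle_independentSetsIn_of_adj rfl huw.symm) hfix
  exact alternatingGroup_le_of_isPreprimitive_of_isThreeCycle_mem
    (isPreprimitive_toggleGroup_independentSetsIn_insert hu huv hprim)
    (isThreeCycle_swap_mul_swap_same (ι.injective.ne hxy) (ι.injective.ne hxz)
      (ι.injective.ne hyz)) hmem

theorem preconnected_induction_insert (hG : G.Preconnected) {p : Set V → Prop} (base : p {u})
    (step : ∀ U, p U → ∀ a ∈ U, ∀ b, G.Adj a b → p (insert b U)) : p Set.univ := by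
  obtain ⟨U, ⟨huU, hpU⟩, hmax⟩ := (Set.toFinite {U | u ∈ U ∧ p U}).exists_maximal ⟨{u}, rfl, base⟩
  suffices hU : U = Set.univ from hU ▸ hpU
  refine Set.eq_univ_of_forall fun b => by_contra fun hb => ?_
  obtain ⟨walk⟩ := hG u b
  obtain ⟨d, -, hd₁, hd₂⟩ := walk.exists_boundary_dart U huU hb
  exact hd₂ (hmax ⟨Or.inr huU, step U hpU _ hd₁ _ d.adj⟩ (Set.subset_insert _ U) (Or.inl rfl))

theorem toggleAlternating_independentSets (hG : G.Preconnected) :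
    ToggleAlternating (independentSets G) := by
  rcases isEmpty_or_nonempty V with hV | ⟨⟨u⟩⟩
  · exact toggleAlternating_of_subsingleton Set.subsingleton_of_subsingleton
  let p (U : Set V) : Prop :=
    IsPreprimitive (toggleGroup (independentSetsIn G U)) (independentSetsIn G U) ∧
      ToggleAlternating (independentSetsIn G U) ∧ (U = {u} ∨ ∀ a ∈ U, ∃ b ∈ U, G.Adj a b)
  have base : p {u} :=
    have hprim := isPreprimitive_toggleGroup_independentSetsIn_singleton u
    ⟨hprim, toggleAlternating_independentSetsIn_of_forall_adj rfl
      (fun _ h hne => absurd h hne) hprim, Or.inl rfl⟩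
  have step (U : Set V) (hU : p U) (a : V) (ha : a ∈ U) (b : V) (hab : G.Adj a b) :
      p (insert b U) := by
    obtain ⟨hprim, halt, rfl | hnbr⟩ := hU
    · obtain rfl : a = u := ha
      have hprim' := isPreprimitive_toggleGroup_independentSetsIn_insert
        (Set.mem_singleton a) hab hprim
      exact ⟨hprim', toggleAlternating_independentSetsIn_of_forall_adj (v := b) (Or.inl rfl)
        (by simp [hab]) hprim', Or.inr (by simp [hab, hab.symm])⟩
    · obtain ⟨c, hc, hac⟩ := hnbr a ha
      refine ⟨isPreprimitive_toggleGroup_independentSetsIn_insert ha hab hprim,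
        toggleAlternating_independentSetsIn_insert ha hc hac hab hprim halt, Or.inr ?_⟩
      rintro d (rfl | hd)
      · exact ⟨a, Or.inr ha, hab.symm⟩
      · exact (hnbr d hd).imp fun _ => And.imp_left Or.inr
  exact independentSetsIn_univ ▸ (preconnected_induction_insert hG base step).2.1

end Finite

end IndependentSets

section Comparability

/-- The comparability graph of a poset, whose independent sets are the antichains. -/
def comparabilityGraph (P : Type*) [PartialOrder P] : SimpleGraph P :=
  SimpleGraph.fromRel (· ≤ ·)

variable {P P₁ P₂ : Type*} [PartialOrder P] [PartialOrder P₁] [PartialOrder P₂]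

theorem antichains_eq_independentSets (P : Type*) [PartialOrder P] :
    antichains P = independentSets (comparabilityGraph P) := by
  ext A
  refine ⟨fun hA a ha b hb hab => ?_, fun hA a ha b hb hab hle => hA ha hb hab ⟨hab, Or.inl hle⟩⟩
  rintro ⟨-, hle | hle⟩
  exacts [hA ha hb hab hle, hA hb ha hab.symm hle]

/-- An order isomorphism from a disjoint union of posets, seen as an isomorphism of comparability
graphs. -/
def sumComparabilityGraphIso (e : P₁ ⊕ P₂ ≃o P) :
    comparabilityGraph P₁ ⊕g comparabilityGraph P₂ ≃g comparabilityGraph P where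
  toEquiv := e.toEquiv
  map_rel_iff' {a b} := by
    rcases a with a | a <;> rcases b with b | b <;> simp [comparabilityGraph]

/-- A poset is the disjoint union of `U` and its complement if no element of `U` is comparable to
an element of the complement. -/
noncomputable def sumComplOrderIso (U : Set P) (hU : ∀ u ∈ U, ∀ v ∉ U, ¬u ≤ v ∧ ¬v ≤ u) :
    U ⊕ (Uᶜ : Set P) ≃o P where
  toEquiv := by classical exact Equiv.Set.sumCompl U
  map_rel_iff' {a b} := by
    rcases a with a | a <;> rcases b with b | b
    · simp
    · simpa using (hU a a.2 b b.2).1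
    · simpa using (hU b b.2 a a.2).2
    · simp

theorem preconnected_comparabilityGraph (hP : ¬IsDisjointUnionOfPosets P) :
    (comparabilityGraph P).Preconnected := by
  intro a b
  by_contra hab
  refine hP ⟨{x | (comparabilityGraph P).Reachable a x},
    ({x | (comparabilityGraph P).Reachable a x}ᶜ : Set P), inferInstance, inferInstance,
    ⟨a, .refl a⟩, ⟨b, hab⟩, ⟨sumComplOrderIso _ fun u hu v hv => ?_⟩⟩
  have hne : u ≠ v := fun h => hv (h ▸ hu)
  have hadj : ¬(comparabilityGraph P).Adj u v := fun h => hv (hu.trans h.reachable)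
  exact ⟨fun h => hadj ⟨hne, Or.inl h⟩, fun h => hadj ⟨hne, Or.inr h⟩⟩

end Comparability

theorem mainTheorem5_general {V : Type*} (G : SimpleGraph V) :
    (∀ (V₁ V₂ : Type*) (G₁ : SimpleGraph V₁) (G₂ : SimpleGraph V₂) (e : G₁ ⊕g G₂ ≃g G),
      ∃ (φ : independentSets G ≃ independentSets G₁ × independentSets G₂)
        (Φ : toggleGroup (independentSets G) ≃*
          toggleGroup (independentSets G₁) × toggleGroup (independentSets G₂)),
        (∀ X : independentSets G,
          ((φ X).1 : Set V₁) = {x | e (Sum.inl x) ∈ (X : Set V)} ∧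
          ((φ X).2 : Set V₂) = {y | e (Sum.inr y) ∈ (X : Set V)}) ∧
        ∀ (g : toggleGroup (independentSets G)) (X : independentSets G),
          φ ((g : Perm (independentSets G)) X) =
            (((Φ g).1 : Perm (independentSets G₁)) (φ X).1,
              ((Φ g).2 : Perm (independentSets G₂)) (φ X).2)) ∧
    ∀ [Finite V], G.Preconnected → ToggleAlternating (independentSets G) := by
  refine ⟨fun V₁ V₂ G₁ G₂ e => ?_, fun hG => toggleAlternating_independentSets hG⟩
  obtain ⟨Φ, hΦ⟩ := exists_toggleGroup_sumFamily_mulEquiv e.toEquiv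
    (independentSets_nonempty G₁) (independentSets_nonempty G₂)
  rw [independentSets_eq_sumFamily e]
  exact ⟨sumFamilyEquiv e.toEquiv _ _, Φ, fun X => ⟨rfl, rfl⟩, hΦ⟩

theorem mainTheorem5 {P : Type*} [PartialOrder P] [Finite P] :
    (∀ (P₁ P₂ : Type*) [PartialOrder P₁] [PartialOrder P₂] (e : P₁ ⊕ P₂ ≃o P),
      ∃ (φ : antichains P ≃ antichains P₁ × antichains P₂)
        (Φ : toggleGroup (antichains P) ≃*
          toggleGroup (antichains P₁) × toggleGroup (antichains P₂)),
        (∀ A : antichains P,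
          ((φ A).1 : Set P₁) = {x | e (Sum.inl x) ∈ (A : Set P)} ∧
          ((φ A).2 : Set P₂) = {y | e (Sum.inr y) ∈ (A : Set P)}) ∧
        ∀ (g : toggleGroup (antichains P)) (A : antichains P),
          φ ((g : Equiv.Perm (antichains P)) A) =
            (((Φ g).1 : Equiv.Perm (antichains P₁)) (φ A).1,
              ((Φ g).2 : Equiv.Perm (antichains P₂)) (φ A).2)) ∧
    (¬ IsDisjointUnionOfPosets P → ToggleAlternating (antichains P)) := by
  obtain ⟨hsum, hconnected⟩ := mainTheorem5_general (comparabilityGraph P)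
  rw [antichains_eq_independentSets P]
  refine ⟨fun P₁ P₂ _ _ e => ?_, fun hP => hconnected (preconnected_comparabilityGraph hP)⟩
  rw [antichains_eq_independentSets P₁, antichains_eq_independentSets P₂]
  exact hsum P₁ P₂ _ _ (sumComparabilityGraphIso e)
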